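/- Let $n\ge 1$ and let $0<p,q,r\le\infty$ satisfy $\frac1p+\frac1q=\frac1r$ (with $\frac1\infty=0$). For a bounded measurable function $m$ on $\mathbb R^n\times\mathbb R^n$ and Schwartz functions $f,g$ on $\mathbb R^n$ put $$M_m(f,g)(x)=\int_{\mathbb R^n}\int_{\mathbb R^n}\hat f(\xi)\,\hat g(\eta)\,m(\xi,\eta)\,e^{2\pi i\, x\cdot(\xi+\eta)}\,d\xi\,d\eta,\qquad \hat f(\xi)=\int_{\mathbb R^n} f(x)e^{-2\pi i\,x\cdot\xi}\,dx,$$ and let $\|m\|_{\mathcal M_{p,q,r}(\mathbb R^n)}\in[0,\infty]$ be the least constant $C$ such that $\|M_m(f,g)\|_{L^r}\le C\|f\|_{L^p}\|g\|_{L^q}$ for all Schwartz functions $f,g$ (so it is $\infty$ if no finite $C$ exists). Let $\phi:\mathbb R^n\to\mathbb R$ be measurable. Suppose that there are $N\ge 1$ cubes $Q_1,\dots,Q_N\subset\mathbb R^n$ (axis-parallel, of positive side length), pairwise distinct vectors $\alpha_1,\dots,\alpha_N\in\mathbb R^n$ and numbers $\beta_1,\dots,\beta_N\in\mathbb R$ such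 that, for each $k$, $\phi(t)=\langle\alpha_k,t\rangle+\beta_k$ for almost every $t\in Q_k$. Then for every unbounded sequence $(\lambda_k)_{k\in\mathbb N}$ of real numbers $$\sup_{k\in\mathbb N}\big\|e^{i\lambda_k\phi(\xi-\eta)}\big\|_{\mathcal M_{p,q,r}(\mathbb R^n)}\ \ge\ N^{\gamma-\frac12},\qquad \gamma=\max\Big\{\frac1p,\frac1q,\frac1{r'}\Big\},\quad \frac1{r'}=1-\frac1r .$$ -/

import Mathlib

open MeasureTheory
open scoped ENNReal FourierTransform SchwartzMap

/-- The bilinear Fourier multiplier operator with symbol `m`, on Schwartz functions: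
`M_m(f,g)(x) = ∫ ∫ f̂(ξ) ĝ(η) m(ξ,η) e^{2πi x·(ξ+η)} dξ dη`, where
`f̂(ξ) = ∫ f(x) e^{-2πi x·ξ} dx`. -/
noncomputable def bilinearMultiplier {n : ℕ}
    (m : EuclideanSpace ℝ (Fin n) → EuclideanSpace ℝ (Fin n) → ℂ)
    (f g : 𝓢(EuclideanSpace ℝ (Fin n), ℂ)) (x : EuclideanSpace ℝ (Fin n)) : ℂ :=
  ∫ ξ : EuclideanSpace ℝ (Fin n), ∫ η : EuclideanSpace ℝ (Fin n),
    𝓕 (f : EuclideanSpace ℝ (Fin n) → ℂ) ξ * 𝓕 (g : EuclideanSpace ℝ (Fin n) → ℂ) η * m ξ η *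
      Complex.exp (2 * Real.pi * Complex.I * (inner ℝ x (ξ + η) : ℝ))

/-- The bilinear multiplier norm `‖m‖_{𝓜_{p,q,r}(ℝⁿ)}`: the least constant `C ∈ [0,∞]` with
`‖M_m(f,g)‖_{L^r} ≤ C ‖f‖_{L^p} ‖g‖_{L^q}` for all Schwartz functions `f`, `g`.
It is `∞` exactly if `m` is not a bilinear multiplier symbol for `(p,q,r)`. -/
noncomputable def bilinearMultiplierNorm {n : ℕ} (p q r : ℝ≥0∞)
    (m : EuclideanSpace ℝ (Fin n) → EuclideanSpace ℝ (Fin n) → ℂ) : ℝ≥0∞ :=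
  sInf {C : ℝ≥0∞ | ∀ f g : 𝓢(EuclideanSpace ℝ (Fin n), ℂ),
    eLpNorm (bilinearMultiplier m f g) r volume ≤
      C * eLpNorm (f : EuclideanSpace ℝ (Fin n) → ℂ) p volume *
        eLpNorm (g : EuclideanSpace ℝ (Fin n) → ℂ) q volume}

/-- The (closed, axis-parallel) cube in `ℝⁿ` with centre `c` and side length `l`. -/
def cube {n : ℕ} (c : EuclideanSpace ℝ (Fin n)) (l : ℝ) : Set (EuclideanSpace ℝ (Fin n)) :=
  {t | ∀ i, |t i - c i| ≤ l / 2}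

/-- A set is a cube if it is an axis-parallel cube of positive side length. -/
def IsCube {n : ℕ} (Q : Set (EuclideanSpace ℝ (Fin n))) : Prop :=
  ∃ (c : EuclideanSpace ℝ (Fin n)) (l : ℝ), 0 < l ∧ Q = cube c l

/-! If `φ` is affine near `a - b`, then on functions `F`, `G` with frequencies concentrated at `a`
and `b` the operator is almost a unimodular constant times `F(x + sα) G(x - sα)`, where `s =
λ/(2π)`. The error is controlled by the Fourier mass and first moment of `F` and `G`, hence is
independent of `λ` and of the positions of the packets. So wide bumps, of radius `R`, are fixed
first; then `λ` is taken so large that the points `t_k = sα_k` are far apart.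

Three tests give three lower bounds for a uniform constant `T`. With one bump `G` at `0` and `N`
packets of frequency `c_k` at `2t_k` in `F`, the output has modulus about one on `N` disjoint balls,
so `T ≥ N^(1/r - 1/p) = N^(1/q)` (`separated_left`). Exchanging the roles gives `T ≥ N^(1/p)`
(`separated_right`). With packets at `t_k` in `F` and bumps at `-t_k` in `G`, all `N` diagonal
products land on the same ball and the others miss it. Suitable signs make the `L²` norm of the sum
at least `(N|B|)^(1/2)`; Hölder from `L^r` to `L²` on the ball, for `r ≥ 2`, gives `T ≥ N^(1/2 -
1/r)` (`overlapping`). The loss of `1/2` in the exponent is needed only for this third bound. -/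

/-! ### Characters and Fourier inversion. -/

/-- The character `t ↦ e^{2πit}`. -/
noncomputable def expChar (t : ℝ) : ℂ := Complex.exp (2 * Real.pi * Complex.I * (t : ℝ))

lemma norm_expChar (t : ℝ) : ‖expChar t‖ = 1 := by
  have : (2 * Real.pi * Complex.I * (t : ℝ) : ℂ) = ((2 * Real.pi * t : ℝ) : ℂ) * Complex.I := by
    push_cast; ring
  rw [expChar, this, Complex.norm_exp_ofReal_mul_I]

lemma expChar_add (s t : ℝ) : expChar (s + t) = expChar s * expChar t := by
  rw [expChar, expChar, expChar, ← Complex.exp_add]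
  push_cast
  ring_nf

lemma continuous_expChar : Continuous expChar := by
  unfold expChar
  fun_prop

lemma contDiff_expChar : ContDiff ℝ (⊤ : ℕ∞) expChar := by
  unfold expChar
  have : ContDiff ℝ (⊤ : ℕ∞) (fun t : ℝ => (t : ℂ)) := Complex.ofRealCLM.contDiff
  fun_prop

lemma fourier_eq_integral_expChar {n : ℕ} (f : EuclideanSpace ℝ (Fin n) → ℂ)
    (w : EuclideanSpace ℝ (Fin n)) :
    𝓕 f w = ∫ v, expChar (-inner ℝ v w) * f v := by
  rw [Real.fourier_eq']
  refine integral_congr_ae (Filter.Eventually.of_forall fun v => ?_)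
  simp only [expChar, smul_eq_mul]
  congr 2
  push_cast
  ring

lemma integral_fourier_expChar {n : ℕ} (F : 𝓢(EuclideanSpace ℝ (Fin n), ℂ))
    (x : EuclideanSpace ℝ (Fin n)) :
    ∫ ξ, 𝓕 (F : EuclideanSpace ℝ (Fin n) → ℂ) ξ * expChar (inner ℝ x ξ) = F x := by
  have h := Continuous.fourierInv_fourier_eq F.continuous F.integrable (𝓕 F).integrable
  have h' := congrFun h x
  rw [Real.fourierInv_eq'] at h'
  rw [← h']
  refine integral_congr_ae (Filter.Eventually.of_forall fun v => ?_)
  simp only [expChar, smul_eq_mul]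
  rw [mul_comm, real_inner_comm]
  congr 2
  push_cast
  ring

lemma fourier_modulate_translate {n : ℕ} {h F : EuclideanSpace ℝ (Fin n) → ℂ} (a : ℂ)
    (c s : EuclideanSpace ℝ (Fin n))
    (hF : ∀ x, F x = a * expChar (inner ℝ c x) * h (x - s)) (ξ : EuclideanSpace ℝ (Fin n)) :
    𝓕 F ξ = a * expChar (-inner ℝ s (ξ - c)) * 𝓕 h (ξ - c) := by
  rw [fourier_eq_integral_expChar, fourier_eq_integral_expChar, ← integral_const_mul]
  conv_rhs => rw [← integral_sub_right_eq_self _ s]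
  refine integral_congr_ae (Filter.Eventually.of_forall fun v => ?_)
  simp only [hF]
  have : expChar (-inner ℝ v ξ) * expChar (inner ℝ c v) =
      expChar (-inner ℝ s (ξ - c)) * expChar (-inner ℝ (v - s) (ξ - c)) := by
    rw [← expChar_add, ← expChar_add]
    congr 1
    simp only [inner_sub_left, inner_sub_right, real_inner_comm c v]
    ring
  linear_combination (a * h (v - s)) * this

/-! ### Fourier mass and moment; wave packets and wide bumps. -/

/-- Integral of the modulus of the Fourier transform. -/
noncomputable def fourierMass {n : ℕ} (F : EuclideanSpace ℝ (Fin n) → ℂ) : ℝ := ∫ ξ, ‖𝓕 F ξ‖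

/-- First absolute moment of the Fourier transform about `c`. -/
noncomputable def fourierMoment {n : ℕ} (F : EuclideanSpace ℝ (Fin n) → ℂ)
    (c : EuclideanSpace ℝ (Fin n)) : ℝ := ∫ ξ, ‖ξ - c‖ * ‖𝓕 F ξ‖

/-- Translation multiplies the Fourier transform by a phase and modulation shifts it, so the mass
does not depend on where the packet sits; the moment behaves likewise about the shifted frequency.
-/
lemma fourierMass_modulate_translate {n : ℕ} {h F : EuclideanSpace ℝ (Fin n) → ℂ} {a : ℂ}
    (ha : ‖a‖ = 1) (c s : EuclideanSpace ℝ (Fin n))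
    (hF : ∀ x, F x = a * expChar (inner ℝ c x) * h (x - s)) :
    fourierMass F = fourierMass h := by
  unfold fourierMass
  simp only [fourier_modulate_translate a c s hF, norm_mul, ha, norm_expChar, one_mul]
  exact integral_sub_right_eq_self (fun ξ => ‖𝓕 h ξ‖) c

lemma fourierMoment_modulate_translate {n : ℕ} {h F : EuclideanSpace ℝ (Fin n) → ℂ} {a : ℂ}
    (ha : ‖a‖ = 1) (c s : EuclideanSpace ℝ (Fin n))
    (hF : ∀ x, F x = a * expChar (inner ℝ c x) * h (x - s)) :
    fourierMoment F c = fourierMoment h 0 := by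
  unfold fourierMoment
  simp only [fourier_modulate_translate a c s hF, norm_mul, ha, norm_expChar, one_mul, sub_zero]
  exact integral_sub_right_eq_self (fun ξ => ‖ξ‖ * ‖𝓕 h ξ‖) c

/-- Here `c` is the frequency and `s` the position of the packet; compact support of `h` makes the
product with the character Schwartz. -/
lemma exists_wavePacket {n : ℕ} (h : 𝓢(EuclideanSpace ℝ (Fin n), ℂ)) (hc : HasCompactSupport h)
    (a : ℂ) (c s : EuclideanSpace ℝ (Fin n)) :
    ∃ F : 𝓢(EuclideanSpace ℝ (Fin n), ℂ),
      ∀ x, F x = a * expChar (inner ℝ c x) * h (x - s) := by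
  have h1 : HasCompactSupport (fun x => a * expChar (inner ℝ c x) * h (x - s)) := by
    have : HasCompactSupport (fun x => h (x - s)) :=
      hc.comp_homeomorph (Homeomorph.subRight s)
    exact this.mul_left
  have h2 : ContDiff ℝ (⊤ : ℕ∞) (fun x => a * expChar (inner ℝ c x) * h (x - s)) := by
    have h3 : ContDiff ℝ (⊤ : ℕ∞) (fun x => expChar (inner ℝ c x)) :=
      contDiff_expChar.comp (contDiff_const.inner ℝ contDiff_id)
    have h4 := h.smooth ⊤
    fun_prop
  exact ⟨h1.toSchwartzMap h2, fun x => rfl⟩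

lemma fourier_comp_inv_smul {n : ℕ} (h : EuclideanSpace ℝ (Fin n) → ℂ) {R : ℝ} (hR : 0 < R)
    (ξ : EuclideanSpace ℝ (Fin n)) :
    𝓕 (fun x => h (R⁻¹ • x)) ξ = (R : ℂ) ^ n * 𝓕 h (R • ξ) := by
  rw [fourier_eq_integral_expChar, fourier_eq_integral_expChar]
  have := Measure.integral_comp_inv_smul (volume : Measure (EuclideanSpace ℝ (Fin n)))
    (fun v => expChar (-inner ℝ v (R • ξ)) * h v) R
  simp only [finrank_euclideanSpace, Fintype.card_fin, abs_of_pos (pow_pos hR n),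
    Complex.real_smul, Complex.ofReal_pow] at this
  rw [← this]
  refine integral_congr_ae (Filter.Eventually.of_forall fun v => ?_)
  simp only [inner_smul_left, inner_smul_right]
  congr 3
  simp [hR.ne']

lemma fourierMass_comp_inv_smul {n : ℕ} (h : EuclideanSpace ℝ (Fin n) → ℂ) {R : ℝ} (hR : 0 < R) :
    fourierMass (fun x => h (R⁻¹ • x)) = fourierMass h := by
  unfold fourierMass
  simp only [fourier_comp_inv_smul h hR, norm_mul, norm_pow, Complex.norm_real, Real.norm_eq_abs,
    abs_of_pos hR]
  rw [integral_const_mul, Measure.integral_comp_smul volume (fun ξ => ‖𝓕 h ξ‖) R]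
  simp only [finrank_euclideanSpace, Fintype.card_fin, abs_of_pos (inv_pos.2 (pow_pos hR n)),
    smul_eq_mul]
  field_simp

/-- Dilation preserves the mass but gains `R⁻¹` in the moment; this gain makes the approximation
error small for wide bumps. -/
lemma fourierMoment_comp_inv_smul {n : ℕ} (h : EuclideanSpace ℝ (Fin n) → ℂ) {R : ℝ}
    (hR : 0 < R) :
    fourierMoment (fun x => h (R⁻¹ • x)) 0 = R⁻¹ * fourierMoment h 0 := by
  unfold fourierMoment
  simp only [fourier_comp_inv_smul h hR, norm_mul, norm_pow, Complex.norm_real, Real.norm_eq_abs,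
    abs_of_pos hR, sub_zero]
  have : ∀ ξ : EuclideanSpace ℝ (Fin n), ‖ξ‖ * (R ^ n * ‖𝓕 h (R • ξ)‖) =
      (R ^ n * R⁻¹) * (‖R • ξ‖ * ‖𝓕 h (R • ξ)‖) := by
    intro ξ
    rw [norm_smul, Real.norm_eq_abs, abs_of_pos hR]
    field_simp
  simp only [this]
  rw [integral_const_mul, Measure.integral_comp_smul volume (fun ξ => ‖ξ‖ * ‖𝓕 h ξ‖) R]
  simp only [finrank_euclideanSpace, Fintype.card_fin, abs_of_pos (inv_pos.2 (pow_pos hR n)),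
    smul_eq_mul]
  field_simp

/-- Almost-indicator functions of large balls whose Fourier transforms are concentrated at `0`. -/
lemma exists_concentrated_bump (n : ℕ) {ρ κ : ℝ} (hρ : 1 < ρ) (hκ : 0 < κ) :
    ∃ R : ℝ, 0 < R ∧ ∃ h : 𝓢(EuclideanSpace ℝ (Fin n), ℂ), HasCompactSupport h ∧
      (∀ x, ‖h x‖ ≤ 1) ∧ (∀ x ∈ Metric.ball 0 R, h x = 1) ∧
      (∀ x ∉ Metric.ball 0 (ρ * R), h x = 0) ∧
      fourierMass h * fourierMoment h 0 ≤ κ := by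
  let b : ContDiffBump (0 : EuclideanSpace ℝ (Fin n)) := ⟨1, ρ, one_pos, hρ⟩
  let h₀ : EuclideanSpace ℝ (Fin n) → ℂ := fun x => (b x : ℂ)
  obtain ⟨R, hR, hRκ⟩ : ∃ R : ℝ, 0 < R ∧ R⁻¹ * (fourierMass h₀ * fourierMoment h₀ 0) ≤ κ := by
    -- The summand `1` keeps `R` positive even if the product vanishes.
    refine ⟨(|fourierMass h₀ * fourierMoment h₀ 0| + 1) / κ, by positivity, ?_⟩
    rw [inv_div, div_mul_eq_mul_div, div_le_iff₀ (by positivity)]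
    nlinarith [le_abs_self (fourierMass h₀ * fourierMoment h₀ 0)]
  have h2 : ContDiff ℝ (⊤ : ℕ∞) (fun x => h₀ (R⁻¹ • x)) := by
    have : ContDiff ℝ (⊤ : ℕ∞) h₀ := Complex.ofRealCLM.contDiff.comp b.contDiff
    fun_prop
  have h1 : HasCompactSupport (fun x => h₀ (R⁻¹ • x)) := by
    have : HasCompactSupport h₀ := b.hasCompactSupport.comp_left Complex.ofReal_zero
    exact this.comp_smul (inv_ne_zero hR.ne')
  have hn : ∀ x : EuclideanSpace ℝ (Fin n), ‖R⁻¹ • x‖ = R⁻¹ * ‖x‖ := fun x => by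
    rw [norm_smul, Real.norm_eq_abs, abs_of_pos (inv_pos.2 hR)]
  refine ⟨R, hR, h1.toSchwartzMap h2, h1, fun x => ?_, fun x hx => ?_, fun x hx => ?_, ?_⟩
  · change ‖((b (R⁻¹ • x) : ℝ) : ℂ)‖ ≤ 1
    rw [Complex.norm_real, Real.norm_eq_abs, abs_of_nonneg b.nonneg]
    exact b.le_one
  · change ((b (R⁻¹ • x) : ℝ) : ℂ) = 1
    rw [b.one_of_mem_closedBall, Complex.ofReal_one]
    rw [mem_closedBall_zero_iff, hn]
    rw [mem_ball_zero_iff] at hx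
    change R⁻¹ * ‖x‖ ≤ 1
    rw [inv_mul_le_iff₀ hR]
    linarith
  · change ((b (R⁻¹ • x) : ℝ) : ℂ) = 0
    rw [b.zero_of_le_dist, Complex.ofReal_zero]
    rw [dist_zero_right, hn]
    rw [mem_ball_zero_iff, not_lt] at hx
    change ρ ≤ R⁻¹ * ‖x‖
    rw [le_inv_mul_iff₀ hR]
    linarith
  · change fourierMass (fun x => h₀ (R⁻¹ • x)) * fourierMoment (fun x => h₀ (R⁻¹ • x)) 0 ≤ κ
    rw [fourierMass_comp_inv_smul h₀ hR, fourierMoment_comp_inv_smul h₀ hR]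
    linarith

/-! ### Measurability, integrability and bilinearity of the operator. -/

/-- The inner integral in the definition of `bilinearMultiplier`, without its `ξ`-factors. -/
noncomputable def partialMultiplier {n : ℕ}
    (m : EuclideanSpace ℝ (Fin n) → EuclideanSpace ℝ (Fin n) → ℂ)
    (G : EuclideanSpace ℝ (Fin n) → ℂ) (x ξ : EuclideanSpace ℝ (Fin n)) : ℂ :=
  ∫ η, 𝓕 G η * m ξ η * expChar (inner ℝ x η)

section
variable {n : ℕ} {m : EuclideanSpace ℝ (Fin n) → EuclideanSpace ℝ (Fin n) → ℂ}

lemma bilinearMultiplier_eq (m : EuclideanSpace ℝ (Fin n) → EuclideanSpace ℝ (Fin n) → ℂ)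
    (F G : 𝓢(EuclideanSpace ℝ (Fin n), ℂ)) (x : EuclideanSpace ℝ (Fin n)) :
    bilinearMultiplier m F G x =
      ∫ ξ, 𝓕 (F : EuclideanSpace ℝ (Fin n) → ℂ) ξ * expChar (inner ℝ x ξ) *
        partialMultiplier m G x ξ := by
  unfold bilinearMultiplier partialMultiplier
  refine integral_congr_ae (Filter.Eventually.of_forall fun ξ => ?_)
  simp only
  rw [← integral_const_mul]
  refine integral_congr_ae (Filter.Eventually.of_forall fun η => ?_)
  have := expChar_add (inner ℝ x ξ) (inner ℝ x η)
  rw [← inner_add_right] at this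
  change _ * expChar (inner ℝ x (ξ + η)) = _
  rw [this]
  ring

lemma integrable_fourier (F : 𝓢(EuclideanSpace ℝ (Fin n), ℂ)) :
    Integrable (𝓕 (F : EuclideanSpace ℝ (Fin n) → ℂ)) := (𝓕 F).integrable

lemma continuous_fourier (F : 𝓢(EuclideanSpace ℝ (Fin n), ℂ)) :
    Continuous (𝓕 (F : EuclideanSpace ℝ (Fin n) → ℂ)) := (𝓕 F).continuous

lemma integrable_fourier_moment (F : 𝓢(EuclideanSpace ℝ (Fin n), ℂ))
    (c : EuclideanSpace ℝ (Fin n)) :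
    Integrable (fun ξ => ‖ξ - c‖ * ‖𝓕 (F : EuclideanSpace ℝ (Fin n) → ℂ) ξ‖) := by
  have h1 := (𝓕 F).integrable_pow_mul volume 1
  have h2 := ((𝓕 F).integrable (μ := volume)).norm.const_mul ‖c‖
  refine (h1.add h2).mono' ?_ (Filter.Eventually.of_forall fun ξ => ?_)
  · have := continuous_fourier F
    exact Continuous.aestronglyMeasurable (by fun_prop)
  · rw [Real.norm_eq_abs, abs_of_nonneg (by positivity)]
    change _ ≤ ‖ξ‖ ^ 1 * ‖𝓕 (F : EuclideanSpace ℝ (Fin n) → ℂ) ξ‖ +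
      ‖c‖ * ‖𝓕 (F : EuclideanSpace ℝ (Fin n) → ℂ) ξ‖
    rw [pow_one, ← add_mul]
    gcongr
    exact norm_sub_le ξ c

lemma stronglyMeasurable_partialMultiplier (hm : Measurable (Function.uncurry m))
    (G : 𝓢(EuclideanSpace ℝ (Fin n), ℂ)) :
    StronglyMeasurable fun z : EuclideanSpace ℝ (Fin n) × EuclideanSpace ℝ (Fin n) =>
      partialMultiplier m G z.1 z.2 := by
  unfold partialMultiplier
  refine StronglyMeasurable.integral_prod_right (f := fun
    (z : EuclideanSpace ℝ (Fin n) × EuclideanSpace ℝ (Fin n)) (η : EuclideanSpace ℝ (Fin n)) =>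
    𝓕 (G : EuclideanSpace ℝ (Fin n) → ℂ) η * m z.2 η * expChar (inner ℝ z.1 η)) ?_
  refine Measurable.stronglyMeasurable ?_
  have h1 := (continuous_fourier G).measurable
  have h2 := continuous_expChar.measurable
  have h3 : Measurable fun w : (EuclideanSpace ℝ (Fin n) × EuclideanSpace ℝ (Fin n)) ×
      EuclideanSpace ℝ (Fin n) => m w.1.2 w.2 :=
    hm.comp (measurable_fst.snd.prodMk measurable_snd)
  unfold Function.uncurry
  fun_prop

lemma integrable_partialMultiplier_integrand (hm : Measurable (Function.uncurry m))
    (hm1 : ∀ ξ η, ‖m ξ η‖ ≤ 1) (G : 𝓢(EuclideanSpace ℝ (Fin n), ℂ))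
    (x ξ : EuclideanSpace ℝ (Fin n)) :
    Integrable fun η =>
      𝓕 (G : EuclideanSpace ℝ (Fin n) → ℂ) η * m ξ η * expChar (inner ℝ x η) := by
  refine (integrable_fourier G).norm.mono' ?_ (Filter.Eventually.of_forall fun η => ?_)
  · have h1 := (continuous_fourier G).measurable
    have h2 := continuous_expChar.measurable
    have h3 : Measurable fun η => m ξ η := hm.comp measurable_prodMk_left
    exact Measurable.aestronglyMeasurable (by fun_prop)
  · rw [norm_mul, norm_mul, norm_expChar, mul_one]
    exact mul_le_of_le_one_right (norm_nonneg _) (hm1 ξ η)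

lemma norm_partialMultiplier_le (hm1 : ∀ ξ η, ‖m ξ η‖ ≤ 1)
    (G : 𝓢(EuclideanSpace ℝ (Fin n), ℂ)) (x ξ : EuclideanSpace ℝ (Fin n)) :
    ‖partialMultiplier m G x ξ‖ ≤ fourierMass G := by
  refine norm_integral_le_of_norm_le (integrable_fourier G).norm
    (Filter.Eventually.of_forall fun η => ?_)
  rw [norm_mul, norm_mul, norm_expChar, mul_one]
  exact mul_le_of_le_one_right (norm_nonneg _) (hm1 ξ η)

lemma integrable_bilinearMultiplier_integrand (hm : Measurable (Function.uncurry m))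
    (hm1 : ∀ ξ η, ‖m ξ η‖ ≤ 1) (F G : 𝓢(EuclideanSpace ℝ (Fin n), ℂ))
    (x : EuclideanSpace ℝ (Fin n)) :
    Integrable fun ξ => 𝓕 (F : EuclideanSpace ℝ (Fin n) → ℂ) ξ * expChar (inner ℝ x ξ) *
        partialMultiplier m G x ξ := by
  refine ((integrable_fourier F).norm.mul_const (fourierMass G)).mono' ?_
    (Filter.Eventually.of_forall fun ξ => ?_)
  · have h1 := (continuous_fourier F).measurable
    have h2 := continuous_expChar.measurable
    have h3 : Measurable fun ξ => partialMultiplier m G x ξ :=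
      (stronglyMeasurable_partialMultiplier hm G).measurable.comp measurable_prodMk_left
    exact Measurable.aestronglyMeasurable (by fun_prop)
  · rw [norm_mul, norm_mul, norm_expChar, mul_one]
    gcongr
    exact norm_partialMultiplier_le hm1 G x ξ

lemma stronglyMeasurable_bilinearMultiplier (hm : Measurable (Function.uncurry m))
    (F G : 𝓢(EuclideanSpace ℝ (Fin n), ℂ)) :
    StronglyMeasurable (bilinearMultiplier m F G) := by
  have : bilinearMultiplier m F G = fun x => _ := funext (bilinearMultiplier_eq m F G)
  rw [this]
  refine StronglyMeasurable.integral_prod_right (f := fun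
    (x ξ : EuclideanSpace ℝ (Fin n)) => 𝓕 (F : EuclideanSpace ℝ (Fin n) → ℂ) ξ *
      expChar (inner ℝ x ξ) * partialMultiplier m G x ξ) ?_
  refine Measurable.stronglyMeasurable ?_
  have h1 := (continuous_fourier F).measurable
  have h2 := continuous_expChar.measurable
  have h3 := (stronglyMeasurable_partialMultiplier hm G).measurable
  unfold Function.uncurry
  fun_prop

lemma fourier_sum {ι : Type*} (s : Finset ι) (F : ι → 𝓢(EuclideanSpace ℝ (Fin n), ℂ))
    (ξ : EuclideanSpace ℝ (Fin n)) :
    𝓕 ((∑ k ∈ s, F k : 𝓢(EuclideanSpace ℝ (Fin n), ℂ)) : EuclideanSpace ℝ (Fin n) → ℂ) ξ =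
      ∑ k ∈ s, 𝓕 (F k : EuclideanSpace ℝ (Fin n) → ℂ) ξ := by
  have h := map_sum (SchwartzMap.fourierTransformCLM ℂ
    (V := EuclideanSpace ℝ (Fin n)) (E := ℂ)) F s
  have h' := congrArg (fun Φ : 𝓢(EuclideanSpace ℝ (Fin n), ℂ) => Φ ξ) h
  rw [sum_apply] at h'
  exact h'

lemma bilinearMultiplier_sum (hm : Measurable (Function.uncurry m))
    (hm1 : ∀ ξ η, ‖m ξ η‖ ≤ 1) {ι κ : Type*} (s : Finset ι) (t : Finset κ)
    (F : ι → 𝓢(EuclideanSpace ℝ (Fin n), ℂ)) (G : κ → 𝓢(EuclideanSpace ℝ (Fin n), ℂ))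
    (x : EuclideanSpace ℝ (Fin n)) :
    bilinearMultiplier m (∑ k ∈ s, F k) (∑ j ∈ t, G j) x =
      ∑ k ∈ s, ∑ j ∈ t, bilinearMultiplier m (F k) (G j) x := by
  have hG : ∀ ξ, partialMultiplier m (∑ j ∈ t, G j : 𝓢(EuclideanSpace ℝ (Fin n), ℂ)) x ξ =
      ∑ j ∈ t, partialMultiplier m (G j) x ξ := by
    intro ξ
    unfold partialMultiplier
    rw [← integral_finsetSum _ fun j _ =>
      integrable_partialMultiplier_integrand hm hm1 (G j) x ξ]
    simp only [fourier_sum, Finset.sum_mul]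
  simp only [bilinearMultiplier_eq]
  simp only [← integral_finsetSum _ fun j _ =>
      integrable_bilinearMultiplier_integrand hm hm1 _ (G j) x]
  rw [← integral_finsetSum _ fun k _ => integrable_finsetSum _ fun j _ =>
      integrable_bilinearMultiplier_integrand hm hm1 (F k) (G j) x]
  simp only [fourier_sum, hG, Finset.sum_mul, Finset.mul_sum]
  refine integral_congr_ae (Filter.Eventually.of_forall fun ξ => ?_)
  exact Finset.sum_comm

end

/-! ### The operator for affine phases, and approximation by it. -/

/-- The symbol `e^{iλφ(ξ-η)}`. -/
noncomputable def phaseSymbol {n : ℕ} (l : ℝ) (φ : EuclideanSpace ℝ (Fin n) → ℝ)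
    (ξ η : EuclideanSpace ℝ (Fin n)) : ℂ :=
  Complex.exp (Complex.I * ((l * φ (ξ - η) : ℝ) : ℂ))

lemma norm_phaseSymbol {n : ℕ} (l : ℝ) (φ : EuclideanSpace ℝ (Fin n) → ℝ)
    (ξ η : EuclideanSpace ℝ (Fin n)) : ‖phaseSymbol l φ ξ η‖ = 1 := by
  rw [phaseSymbol, mul_comm, Complex.norm_exp_ofReal_mul_I]

lemma measurable_phaseSymbol {n : ℕ} (l : ℝ) {φ : EuclideanSpace ℝ (Fin n) → ℝ}
    (hφ : Measurable φ) : Measurable (Function.uncurry (phaseSymbol l φ)) := by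
  unfold Function.uncurry phaseSymbol
  fun_prop

/-- The symbol factors into a constant, a character of `ξ` and a character of `η`; by Fourier
inversion these become opposite translations of `F` and `G`. -/
lemma bilinearMultiplier_phaseSymbol_affine {n : ℕ} (l : ℝ) (α : EuclideanSpace ℝ (Fin n)) (β : ℝ)
    (F G : 𝓢(EuclideanSpace ℝ (Fin n), ℂ)) (x : EuclideanSpace ℝ (Fin n)) :
    bilinearMultiplier (phaseSymbol l fun t => inner ℝ α t + β) F G x =
      expChar (l * β / (2 * Real.pi)) * F (x + (l / (2 * Real.pi)) • α) *
        G (x - (l / (2 * Real.pi)) • α) := by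
  have hs : ∀ ξ η, phaseSymbol l (fun t => inner ℝ α t + β) ξ η =
      expChar (l * β / (2 * Real.pi)) * expChar (inner ℝ ((l / (2 * Real.pi)) • α) ξ) *
        expChar (-inner ℝ ((l / (2 * Real.pi)) • α) η) := by
    intro ξ η
    rw [← expChar_add, ← expChar_add, phaseSymbol, expChar, inner_smul_left, inner_smul_left,
      inner_sub_right]
    congr 1
    have : (Real.pi : ℂ) ≠ 0 := Complex.ofReal_ne_zero.2 Real.pi_ne_zero
    simp only [conj_trivial]
    push_cast
    field_simp
    ring
  rw [bilinearMultiplier_eq, ← integral_fourier_expChar F, ← integral_fourier_expChar G]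
  have hP : ∀ ξ, partialMultiplier (phaseSymbol l fun t => inner ℝ α t + β) G x ξ =
      (expChar (l * β / (2 * Real.pi)) * expChar (inner ℝ ((l / (2 * Real.pi)) • α) ξ)) *
      ∫ η, 𝓕 (G : EuclideanSpace ℝ (Fin n) → ℂ) η *
        expChar (inner ℝ (x - (l / (2 * Real.pi)) • α) η) := by
    intro ξ
    unfold partialMultiplier
    rw [← integral_const_mul]
    refine integral_congr_ae (Filter.Eventually.of_forall fun η => ?_)
    simp only [hs, inner_sub_left, sub_eq_add_neg (inner ℝ x η), expChar_add]
    ring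
  simp only [hP]
  generalize ∫ η, 𝓕 (G : EuclideanSpace ℝ (Fin n) → ℂ) η *
    expChar (inner ℝ (x - (l / (2 * Real.pi)) • α) η) = J
  rw [← integral_const_mul, ← integral_mul_const]
  refine integral_congr_ae (Filter.Eventually.of_forall fun ξ => ?_)
  simp only [inner_add_left, expChar_add]
  ring

/-- If `φ` is affine near `a - b`, then the multiplier acts on pairs of functions with frequencies
near `a` and `b` approximately as a product of translations. -/
lemma norm_bilinearMultiplier_phaseSymbol_sub_le {n : ℕ} (l : ℝ)
    {φ : EuclideanSpace ℝ (Fin n) → ℝ} (hφ : Measurable φ)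
    {α a b : EuclideanSpace ℝ (Fin n)} {β δ : ℝ} (hδ : 0 < δ)
    (haff : ∀ᵐ t, ‖t - (a - b)‖ < δ → φ t = inner ℝ α t + β)
    (F G : 𝓢(EuclideanSpace ℝ (Fin n), ℂ)) (x : EuclideanSpace ℝ (Fin n)) :
    ‖bilinearMultiplier (phaseSymbol l φ) F G x -
      expChar (l * β / (2 * Real.pi)) * F (x + (l / (2 * Real.pi)) • α) *
        G (x - (l / (2 * Real.pi)) • α)‖ ≤
      2 / δ * (fourierMoment F a * fourierMass G + fourierMass F * fourierMoment G b) := by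
  have hm := measurable_phaseSymbol l hφ
  have hφ' : Measurable fun t : EuclideanSpace ℝ (Fin n) => inner ℝ α t + β := by fun_prop
  have hm' := measurable_phaseSymbol l hφ'
  have hP : ∀ ξ, ‖partialMultiplier (phaseSymbol l φ) G x ξ -
      partialMultiplier (phaseSymbol l fun t => inner ℝ α t + β) G x ξ‖ ≤
      2 / δ * (‖ξ - a‖ * fourierMass G + fourierMoment G b) := by
    intro ξ
    unfold partialMultiplier
    rw [← integral_sub
      (integrable_partialMultiplier_integrand hm (fun _ _ => (norm_phaseSymbol _ _ _ _).le) G x ξ)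
      (integrable_partialMultiplier_integrand hm' (fun _ _ => (norm_phaseSymbol _ _ _ _).le) G x ξ),
      fourierMass, fourierMoment, ← integral_const_mul,
      ← integral_add ((integrable_fourier G).norm.const_mul _) (integrable_fourier_moment G b),
      ← integral_const_mul]
    refine norm_integral_le_of_norm_le
      ((((integrable_fourier G).norm.const_mul _).add
        (integrable_fourier_moment G b)).const_mul _) ?_
    -- The affine formula holds only almost everywhere; for each fixed `ξ` the reflection `η ↦ ξ -
    -- η` pulls null sets back to null sets.
    have hq : Measure.QuasiMeasurePreserving (fun η : EuclideanSpace ℝ (Fin n) => ξ - η)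
        volume volume := quasiMeasurePreserving_sub_left volume ξ
    filter_upwards [hq.ae haff] with η hη
    have hle : ‖phaseSymbol l φ ξ η - phaseSymbol l (fun t => inner ℝ α t + β) ξ η‖ ≤
        2 / δ * (‖ξ - a‖ + ‖η - b‖) := by
      -- Either the two symbols agree, or `‖ξ - a‖ + ‖η - b‖ ≥ δ` and the trivial bound `2` for
      -- their difference suffices.
      by_cases hc : ‖ξ - η - (a - b)‖ < δ
      · rw [phaseSymbol, phaseSymbol, hη hc, sub_self, norm_zero]
        positivity
      · have h1 : ‖ξ - η - (a - b)‖ ≤ ‖ξ - a‖ + ‖η - b‖ := by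
          rw [show ξ - η - (a - b) = (ξ - a) - (η - b) by abel]
          exact norm_sub_le _ _
        have h2 : δ ≤ ‖ξ - a‖ + ‖η - b‖ := (not_lt.1 hc).trans h1
        have h3 : 2 ≤ 2 / δ * (‖ξ - a‖ + ‖η - b‖) := by
          rw [div_mul_eq_mul_div, le_div_iff₀ hδ]
          linarith
        refine (norm_sub_le _ _).trans ?_
        rw [norm_phaseSymbol, norm_phaseSymbol]
        linarith
    rw [← sub_mul, ← mul_sub, norm_mul, norm_mul, norm_expChar, mul_one]
    calc _ ≤ ‖𝓕 (G : EuclideanSpace ℝ (Fin n) → ℂ) η‖ * (2 / δ * (‖ξ - a‖ + ‖η - b‖)) := by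
          gcongr
      _ = _ := by ring
  rw [← bilinearMultiplier_phaseSymbol_affine, bilinearMultiplier_eq, bilinearMultiplier_eq,
    ← integral_sub
      (integrable_bilinearMultiplier_integrand hm (fun _ _ => (norm_phaseSymbol _ _ _ _).le) F G x)
      (integrable_bilinearMultiplier_integrand hm' (fun _ _ => (norm_phaseSymbol _ _ _ _).le) F G x),
    fourierMoment, fourierMass.eq_1 F, ← integral_mul_const, ← integral_mul_const,
    ← integral_add ((integrable_fourier_moment F a).mul_const _)
      ((integrable_fourier F).norm.mul_const _), ← integral_const_mul]
  refine norm_integral_le_of_norm_le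
    ((((integrable_fourier_moment F a).mul_const _).add
      ((integrable_fourier F).norm.mul_const _)).const_mul _)
    (Filter.Eventually.of_forall fun ξ => ?_)
  rw [← mul_sub, norm_mul, norm_mul, norm_expChar, mul_one]
  calc _ ≤ ‖𝓕 (F : EuclideanSpace ℝ (Fin n) → ℂ) ξ‖ *
        (2 / δ * (‖ξ - a‖ * fourierMass G + fourierMoment G b)) := by
        gcongr
        exact hP ξ
    _ = _ := by ring

/-! ### `L^p` norms of sums of separated bumps. -/

section
variable {n : ℕ} {ι : Type*} [Fintype ι]

lemma sum_separated_eq_single {h : EuclideanSpace ℝ (Fin n) → ℂ} {R : ℝ}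
    (h0 : ∀ x ∉ Metric.ball 0 R, h x = 0) {s : ι → EuclideanSpace ℝ (Fin n)}
    (hs : ∀ i j, i ≠ j → 2 * R ≤ ‖s i - s j‖) (w : ι → ℂ) {x : EuclideanSpace ℝ (Fin n)} {k : ι}
    (hx : x ∈ Metric.ball (s k) R) :
    ∑ i, w i * h (x - s i) = w k * h (x - s k) := by
  refine Finset.sum_eq_single k (fun i _ hik => ?_) (fun hk => absurd (Finset.mem_univ k) hk)
  rw [h0 (x - s i), mul_zero]
  rw [mem_ball_zero_iff, not_lt]
  have h1 := hs i k hik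
  have h2 : ‖s i - s k‖ ≤ ‖x - s k‖ + ‖x - s i‖ := by
    rw [show s i - s k = (x - s k) - (x - s i) by abel]
    exact norm_sub_le _ _
  rw [mem_ball_iff_norm] at hx
  linarith

lemma eLpNorm_sum_separated_le {h f : EuclideanSpace ℝ (Fin n) → ℂ} {R : ℝ}
    (h1 : ∀ x, ‖h x‖ ≤ 1) (h0 : ∀ x ∉ Metric.ball 0 R, h x = 0)
    {s : ι → EuclideanSpace ℝ (Fin n)} (hs : ∀ i j, i ≠ j → 2 * R ≤ ‖s i - s j‖)
    (w : ι → EuclideanSpace ℝ (Fin n) → ℂ) (hw : ∀ i x, ‖w i x‖ = 1)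
    (hf : ∀ x, f x = ∑ i, w i x * h (x - s i)) (p : ℝ≥0∞) :
    eLpNorm f p volume ≤
      (Fintype.card ι * volume (Metric.ball (0 : EuclideanSpace ℝ (Fin n)) R)) ^
        (1 / p.toReal) := by
  set U : Set (EuclideanSpace ℝ (Fin n)) := ⋃ i, Metric.ball (s i) R with hU
  have hle : ∀ x, ‖f x‖ ≤ ‖U.indicator (fun _ => (1 : ℝ)) x‖ := by
    intro x
    by_cases hx : x ∈ U
    · obtain ⟨k, hk⟩ := Set.mem_iUnion.1 hx
      rw [hf, sum_separated_eq_single h0 hs (fun i => w i x) hk, Set.indicator_of_mem hx,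
        norm_mul, hw, one_mul, norm_one]
      exact h1 _
    · rw [hf, Finset.sum_eq_zero, norm_zero]
      · exact norm_nonneg _
      · intro i _
        rw [h0, mul_zero]
        intro hi
        refine hx (Set.mem_iUnion.2 ⟨i, ?_⟩)
        rwa [mem_ball_iff_norm, ← mem_ball_zero_iff]
  refine (eLpNorm_mono hle).trans ((eLpNorm_indicator_const_le 1 p).trans ?_)
  rw [enorm_one, one_mul]
  gcongr
  calc volume U ≤ ∑ i, volume (Metric.ball (s i) R) := measure_iUnion_fintype_le _ _
    _ = _ := by
      simp only [Measure.addHaar_ball_center volume, Finset.sum_const, Finset.card_univ,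
        nsmul_eq_mul]

lemma le_eLpNorm_of_le_on_balls [Nonempty ι] {F : EuclideanSpace ℝ (Fin n) → ℂ} {R c : ℝ}
    (hR : 0 < R) {s : ι → EuclideanSpace ℝ (Fin n)} (hs : ∀ i j, i ≠ j → 2 * R ≤ ‖s i - s j‖)
    (hc : 0 ≤ c) (hF : ∀ i, ∀ x ∈ Metric.ball (s i) R, c ≤ ‖F x‖) {r : ℝ≥0∞} (hr : r ≠ 0) :
    ENNReal.ofReal c *
      (Fintype.card ι * volume (Metric.ball (0 : EuclideanSpace ℝ (Fin n)) R)) ^ (1 / r.toReal) ≤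
      eLpNorm F r volume := by
  set U : Set (EuclideanSpace ℝ (Fin n)) := ⋃ i, Metric.ball (s i) R with hU
  have hUm : MeasurableSet U := MeasurableSet.iUnion fun i => measurableSet_ball
  have hvol : volume U =
      Fintype.card ι * volume (Metric.ball (0 : EuclideanSpace ℝ (Fin n)) R) := by
    rw [hU, measure_iUnion _ fun i => measurableSet_ball, tsum_fintype]
    · simp only [Measure.addHaar_ball_center volume, Finset.sum_const, Finset.card_univ,
        nsmul_eq_mul]
    · intro i j hij
      refine Metric.ball_disjoint_ball ?_
      rw [dist_eq_norm]
      linarith [hs i j hij]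
  -- Positive volume is essential at `r = ∞`, where `1 / r.toReal = 0` and the bound reads `c ≤
  -- ‖F‖_∞`.
  have hne : volume U ≠ 0 := by
    rw [hvol]
    exact mul_ne_zero (by simp) (Metric.measure_ball_pos volume _ hR).ne'
  rw [← hvol]
  have := eLpNorm_indicator_const' (p := r) (c := c) hUm hne hr
  rw [Real.enorm_eq_ofReal hc] at this
  rw [← this]
  refine eLpNorm_mono fun x => ?_
  by_cases hx : x ∈ U
  · obtain ⟨k, hk⟩ := Set.mem_iUnion.1 hx
    rw [Set.indicator_of_mem hx, Real.norm_of_nonneg hc]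
    exact hF k x hk
  · rw [Set.indicator_of_notMem hx, norm_zero]
    exact norm_nonneg _

end

/-! ### Choice of signs. -/

lemma enorm_parallelogram (a b : ℂ) :
    ‖a + b‖ₑ ^ 2 + ‖a - b‖ₑ ^ 2 = 2 * ‖a‖ₑ ^ 2 + 2 * ‖b‖ₑ ^ 2 := by
  have h := parallelogram_law_with_norm ℝ a b
  have h2 : (2 : ℝ≥0∞) = ENNReal.ofReal 2 := by simp
  simp only [← ofReal_norm, ← ENNReal.ofReal_pow (norm_nonneg _)]
  rw [h2, ← ENNReal.ofReal_mul two_pos.le, ← ENNReal.ofReal_mul two_pos.le,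
    ← ENNReal.ofReal_add (by positivity) (by positivity),
    ← ENNReal.ofReal_add (by positivity) (by positivity)]
  congr 1
  nlinarith

/-- A greedy replacement for averaging over random signs: by the parallelogram law, for one of the
two signs of each new term the square integral grows by at least that of the term. -/
lemma exists_signs_lintegral_le {X ι : Type*} [MeasurableSpace X] [DecidableEq ι] (μ : Measure X)
    (v : ι → X → ℂ) (hv : ∀ i, Measurable (v i)) (s : Finset ι) :
    ∃ σ : ι → ℂ, (∀ i, ‖σ i‖ = 1) ∧
      ∑ i ∈ s, ∫⁻ x, ‖v i x‖ₑ ^ 2 ∂μ ≤ ∫⁻ x, ‖∑ i ∈ s, σ i * v i x‖ₑ ^ 2 ∂μ := by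
  induction s using Finset.induction_on with
  | empty => exact ⟨fun _ => 1, fun _ => norm_one, by simp⟩
  | insert i s hi ih =>
    obtain ⟨σ, hσ, hle⟩ := ih
    set G : X → ℂ := fun x => ∑ j ∈ s, σ j * v j x with hG
    have hGm : Measurable G := by
      refine Finset.measurable_fun_sum s fun j _ => ?_
      have := hv j
      fun_prop
    have hvi := hv i
    have hsum : (∫⁻ x, ‖G x + v i x‖ₑ ^ 2 ∂μ) + ∫⁻ x, ‖G x - v i x‖ₑ ^ 2 ∂μ =
        2 * ((∫⁻ x, ‖v i x‖ₑ ^ 2 ∂μ) + ∫⁻ x, ‖G x‖ₑ ^ 2 ∂μ) := by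
      rw [← lintegral_add_left (by fun_prop)]
      simp only [enorm_parallelogram]
      rw [lintegral_add_left (by fun_prop), lintegral_const_mul _ (by fun_prop),
        lintegral_const_mul _ (by fun_prop)]
      ring
    have hor : ∃ e : ℂ, ‖e‖ = 1 ∧ (∫⁻ x, ‖v i x‖ₑ ^ 2 ∂μ) + ∫⁻ x, ‖G x‖ₑ ^ 2 ∂μ ≤
        ∫⁻ x, ‖G x + e * v i x‖ₑ ^ 2 ∂μ := by
      by_contra! hcon
      have h1 := hcon 1 norm_one
      have h2 := hcon (-1) (by simp)
      simp only [one_mul, neg_one_mul, ← sub_eq_add_neg] at h1 h2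
      have h3 := ENNReal.add_lt_add h1 h2
      rw [hsum, two_mul] at h3
      exact lt_irrefl _ h3
    obtain ⟨e, he, hee⟩ := hor
    refine ⟨Function.update σ i e, fun j => ?_, ?_⟩
    · by_cases hj : j = i
      · subst hj; simpa using he
      · simpa [hj] using hσ j
    · rw [Finset.sum_insert hi]
      refine (add_le_add_right hle _).trans (hee.trans (le_of_eq ?_))
      refine lintegral_congr fun x => ?_
      rw [Finset.sum_insert hi, Function.update_self, add_comm, hG]
      congr 3
      refine Finset.sum_congr rfl fun j hj => ?_
      rw [Function.update_of_ne (ne_of_mem_of_not_mem hj hi)]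

/-! ### Error for sums of packets, and separation by large `λ`. -/

/-- The `N` affine pieces of the phase, sampled on balls of radius `δ` about the points `c k`. -/
structure IsPiecewiseAffine {n : ℕ} {ι : Type*} (φ : EuclideanSpace ℝ (Fin n) → ℝ) (δ : ℝ)
    (c α : ι → EuclideanSpace ℝ (Fin n)) (β : ι → ℝ) : Prop where
  measurable : Measurable φ
  pos : 0 < δ
  affine : ∀ k, ∀ᵐ t, ‖t - c k‖ < δ → φ t = inner ℝ (α k) t + β k

/-- Every pair of packets has the mass and moment of `h`, so it costs at most `4/δ · ε`. The bound
does not involve `l`, which leaves `λ` free to be chosen after `h`. -/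
lemma norm_bilinearMultiplier_sum_sub_le {n : ℕ} {ι κ γ : Type*} [Fintype κ] [Fintype γ]
    {φ : EuclideanSpace ℝ (Fin n) → ℝ} {δ : ℝ} {c α : ι → EuclideanSpace ℝ (Fin n)} {β : ι → ℝ}
    (H : IsPiecewiseAffine φ δ c α β) (l : ℝ)
    {h : EuclideanSpace ℝ (Fin n) → ℂ} {ε : ℝ} (hε : fourierMass h * fourierMoment h 0 ≤ ε)
    (F : κ → 𝓢(EuclideanSpace ℝ (Fin n), ℂ)) (G : γ → 𝓢(EuclideanSpace ℝ (Fin n), ℂ))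
    (d : κ → γ → ι) (a : κ → EuclideanSpace ℝ (Fin n)) (b : γ → EuclideanSpace ℝ (Fin n))
    (hd : ∀ i j, a i - b j = c (d i j))
    (hF : ∀ i, fourierMass (F i) = fourierMass h ∧
      fourierMoment (F i) (a i) = fourierMoment h 0)
    (hG : ∀ j, fourierMass (G j) = fourierMass h ∧
      fourierMoment (G j) (b j) = fourierMoment h 0)
    (x : EuclideanSpace ℝ (Fin n)) :
    ‖bilinearMultiplier (phaseSymbol l φ) (∑ i, F i) (∑ j, G j) x -
      ∑ i, ∑ j, expChar (l * β (d i j) / (2 * Real.pi)) *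
        F i (x + (l / (2 * Real.pi)) • α (d i j)) *
        G j (x - (l / (2 * Real.pi)) • α (d i j))‖ ≤
      Fintype.card κ * (Fintype.card γ * (4 / δ * ε)) := by
  rw [bilinearMultiplier_sum (measurable_phaseSymbol l H.measurable)
    (fun _ _ => (norm_phaseSymbol _ _ _ _).le), ← Finset.sum_sub_distrib]
  simp only [← Finset.sum_sub_distrib]
  refine (norm_sum_le _ _).trans ?_
  refine (Finset.sum_le_card_nsmul _ _ (Fintype.card γ * (4 / δ * ε)) fun i _ => ?_).trans
    (le_of_eq (by rw [nsmul_eq_mul, Finset.card_univ]))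
  refine (norm_sum_le _ _).trans ?_
  refine (Finset.sum_le_card_nsmul _ _ (4 / δ * ε) fun j _ => ?_).trans
    (le_of_eq (by rw [nsmul_eq_mul, Finset.card_univ]))
  have haff := H.affine (d i j)
  rw [← hd i j] at haff
  refine (norm_bilinearMultiplier_phaseSymbol_sub_le l H.measurable H.pos haff
    (F i) (G j) x).trans ?_
  rw [(hF i).1, (hF i).2, (hG j).1, (hG j).2]
  have := H.pos
  calc _ = 4 / δ * (fourierMass h * fourierMoment h 0) := by ring
    _ ≤ _ := by gcongr

lemma exists_separated_dilate {n : ℕ} {ι : Type*} [Fintype ι]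
    {α : ι → EuclideanSpace ℝ (Fin n)} (hα : Function.Injective α)
    {lam : ℕ → ℝ} (hlam : ∀ C : ℝ, ∃ k, C < |lam k|) {D : ℝ} (hD : 0 ≤ D) :
    ∃ k, ∀ i j, i ≠ j →
      D ≤ ‖(lam k / (2 * Real.pi)) • α i - (lam k / (2 * Real.pi)) • α j‖ := by
  -- The sum dominates each separation threshold; its diagonal terms are divisions by zero, hence
  -- `0`.
  obtain ⟨k, hk⟩ := hlam (∑ i, ∑ j, D * (2 * Real.pi) / ‖α i - α j‖)
  refine ⟨k, fun i j hij => ?_⟩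
  have hpos : 0 < ‖α i - α j‖ := norm_pos_iff.2 (sub_ne_zero.2 (hα.ne hij))
  have h1 : D * (2 * Real.pi) / ‖α i - α j‖ ≤ |lam k| := by
    refine le_trans ?_ hk.le
    refine le_trans ?_ (Finset.single_le_sum (f := fun i => ∑ j, D * (2 * Real.pi) / ‖α i - α j‖)
      (fun i _ => Finset.sum_nonneg fun j _ => by positivity) (Finset.mem_univ i))
    exact Finset.single_le_sum (f := fun j => D * (2 * Real.pi) / ‖α i - α j‖)
      (fun j _ => by positivity) (Finset.mem_univ j)
  rw [div_le_iff₀ hpos] at h1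
  rw [← smul_sub, norm_smul, Real.norm_eq_abs, abs_div, abs_of_pos Real.two_pi_pos,
    div_mul_eq_mul_div, le_div_iff₀ Real.two_pi_pos]
  exact h1

/-! ### The three test configurations. -/

section
variable {n N : ℕ} {φ : EuclideanSpace ℝ (Fin n) → ℝ} {δ : ℝ}
  {c α : Fin N → EuclideanSpace ℝ (Fin n)} {β : Fin N → ℝ} {lam : ℕ → ℝ} {p q r T : ℝ≥0∞}

/-- All symbols `e^{iλ_kφ(ξ-η)}` satisfy the multiplier bound with the constant `T`. -/
def UniformMultiplierBound {n : ℕ} (φ : EuclideanSpace ℝ (Fin n) → ℝ) (lam : ℕ → ℝ)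
    (p q r T : ℝ≥0∞) : Prop :=
  ∀ k, ∀ f g : 𝓢(EuclideanSpace ℝ (Fin n), ℂ),
    eLpNorm (bilinearMultiplier (phaseSymbol (lam k) φ) f g) r volume ≤
      T * eLpNorm (f : EuclideanSpace ℝ (Fin n) → ℂ) p volume *
        eLpNorm (g : EuclideanSpace ℝ (Fin n) → ℂ) q volume

lemma expChar_zero : expChar 0 = 1 := by simp [expChar]

/-- Many packets in `F` against one bump in `G`: the output is spread over `N` disjoint balls about
the `t i`. -/
lemma UniformMultiplierBound.separated_left (H : IsPiecewiseAffine φ δ c α β)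
    (hα : Function.Injective α) (hlam : ∀ C : ℝ, ∃ k, C < |lam k|) (hN : 0 < N) (hr : r ≠ 0)
    (hT : UniformMultiplierBound φ lam p q r T) {ρ τ : ℝ} (hρ : 1 < ρ) (hτ : 0 < τ)
    (hτ1 : τ ≤ 1) :
    ∃ R : ℝ, 0 < R ∧ ENNReal.ofReal (1 - τ) *
      (N * volume (Metric.ball (0 : EuclideanSpace ℝ (Fin n)) R)) ^ (1 / r.toReal) ≤
      T * (N * volume (Metric.ball (0 : EuclideanSpace ℝ (Fin n)) (ρ * R))) ^ (1 / p.toReal) *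
        volume (Metric.ball (0 : EuclideanSpace ℝ (Fin n)) (ρ * R)) ^ (1 / q.toReal) := by
  have hδ := H.pos
  have hN' : (0 : ℝ) < N := by exact_mod_cast hN
  have : Nonempty (Fin N) := ⟨⟨0, hN⟩⟩
  obtain ⟨R, hR, h, hcs, h1, hin, hout, hsmall⟩ :=
    -- There are `N` pairs of packets, each with error `4/δ · κ`, so the total error is `τ`.
    exists_concentrated_bump n hρ (κ := τ * δ / (4 * N)) (by positivity)
  have hRρ : R ≤ ρ * R := le_mul_of_one_le_left hR.le hρ.le
  obtain ⟨k, hk⟩ := exists_separated_dilate hα hlam (D := 2 * (ρ * R)) (by positivity)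
  set t : Fin N → EuclideanSpace ℝ (Fin n) := fun i => (lam k / (2 * Real.pi)) • α i with ht
  have hk' : ∀ i j, i ≠ j → 2 * (ρ * R) ≤ ‖t i - t j‖ := hk
  -- Position `2 t i` is forced: `F i (x + t i)` is then centred at `t i`, exactly where `h (x - t
  -- i)` lives.
  choose F hF using fun i => exists_wavePacket h hcs 1 (c i) ((2 : ℝ) • t i)
  have hFm : ∀ i, fourierMass (F i) = fourierMass h ∧
      fourierMoment (F i) (c i) = fourierMoment h 0 := fun i =>
    ⟨fourierMass_modulate_translate norm_one _ _ (hF i),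
      fourierMoment_modulate_translate norm_one _ _ (hF i)⟩
  have happrox := norm_bilinearMultiplier_sum_sub_le H (lam k) hsmall F (fun _ : Unit => h)
    (fun i _ => i) c (fun _ => 0) (fun i _ => sub_zero _) hFm (fun _ => ⟨rfl, rfl⟩)
  simp only [Finset.univ_unique, Finset.sum_singleton, Fintype.card_fin, Fintype.card_unit,
    Nat.cast_one, one_mul] at happrox
  have herr : N * (4 / δ * (τ * δ / (4 * N))) = τ := by field_simp
  rw [herr] at happrox
  refine ⟨R, hR, ?_⟩
  have hlow := le_eLpNorm_of_le_on_balls (ι := Fin N) (c := 1 - τ)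
    (F := bilinearMultiplier (phaseSymbol (lam k) φ) (∑ i, F i) h) hR
    (fun i j hij => le_trans (by linarith) (hk' i j hij)) (by linarith) (fun i x hx => ?_) hr
  · rw [Fintype.card_fin] at hlow
    refine hlow.trans ((hT k (∑ i, F i) h).trans ?_)
    gcongr
    · have := eLpNorm_sum_separated_le (f := ⇑(∑ i, F i)) (s := fun i => (2 : ℝ) • t i) h1 hout
        (fun i j hij => ?_) (fun i x => 1 * expChar (inner ℝ (c i) x))
        (fun i x => by rw [one_mul, norm_expChar]) (fun x => ?_) p
      · rwa [Fintype.card_fin] at this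
      · rw [← smul_sub, norm_smul, Real.norm_eq_abs, abs_two]
        linarith [hk' i j hij, norm_nonneg (t i - t j)]
      · rw [sum_apply]
        exact Finset.sum_congr rfl fun i _ => hF i x
    · have := eLpNorm_sum_separated_le (ι := Unit) (f := h) (s := fun _ => 0) h1 hout
        (fun i j hij => absurd (Subsingleton.elim i j) hij) (fun _ _ => 1)
        (fun _ _ => norm_one) (fun x => by simp) q
      simpa using this
  · have hmain : ∑ j, expChar (lam k * β j / (2 * Real.pi)) * F j (x + t j) * h (x - t j) =
        expChar (lam k * β i / (2 * Real.pi)) * F i (x + t i) := by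
      rw [sum_separated_eq_single hout hk'
        (fun j => expChar (lam k * β j / (2 * Real.pi)) * F j (x + t j))
        (Metric.ball_subset_ball hRρ hx), hin (x - t i), mul_one]
      rwa [mem_ball_zero_iff, ← mem_ball_iff_norm]
    have hone : ‖expChar (lam k * β i / (2 * Real.pi)) * F i (x + t i)‖ = 1 := by
      rw [hF, show x + t i - (2 : ℝ) • t i = x - t i by rw [two_smul]; abel, hin (x - t i)]
      · simp only [norm_mul, norm_expChar, norm_one, mul_one]
      · rwa [mem_ball_zero_iff, ← mem_ball_iff_norm]
    have := happrox x
    rw [hmain] at this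
    have h3 := norm_sub_norm_le (expChar (lam k * β i / (2 * Real.pi)) * F i (x + t i))
      (bilinearMultiplier (phaseSymbol (lam k) φ) (∑ i, F i) h x)
    rw [norm_sub_rev, hone] at h3
    linarith

lemma UniformMultiplierBound.separated_right (H : IsPiecewiseAffine φ δ c α β)
    (hα : Function.Injective α) (hlam : ∀ C : ℝ, ∃ k, C < |lam k|) (hN : 0 < N) (hr : r ≠ 0)
    (hT : UniformMultiplierBound φ lam p q r T) {ρ τ : ℝ} (hρ : 1 < ρ) (hτ : 0 < τ)
    (hτ1 : τ ≤ 1) :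
    ∃ R : ℝ, 0 < R ∧ ENNReal.ofReal (1 - τ) *
      (N * volume (Metric.ball (0 : EuclideanSpace ℝ (Fin n)) R)) ^ (1 / r.toReal) ≤
      T * volume (Metric.ball (0 : EuclideanSpace ℝ (Fin n)) (ρ * R)) ^ (1 / p.toReal) *
        (N * volume (Metric.ball (0 : EuclideanSpace ℝ (Fin n)) (ρ * R))) ^ (1 / q.toReal) := by
  have hδ := H.pos
  have hN' : (0 : ℝ) < N := by exact_mod_cast hN
  have : Nonempty (Fin N) := ⟨⟨0, hN⟩⟩
  obtain ⟨R, hR, h, hcs, h1, hin, hout, hsmall⟩ :=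
    exists_concentrated_bump n hρ (κ := τ * δ / (4 * N)) (by positivity)
  have hRρ : R ≤ ρ * R := le_mul_of_one_le_left hR.le hρ.le
  obtain ⟨k, hk⟩ := exists_separated_dilate hα hlam (D := 2 * (ρ * R)) (by positivity)
  set t : Fin N → EuclideanSpace ℝ (Fin n) := fun i => (lam k / (2 * Real.pi)) • α i with ht
  have hk' : ∀ i j, i ≠ j → 2 * (ρ * R) ≤ ‖(-t i) - (-t j)‖ := fun i j hij => by
    rw [neg_sub_neg, norm_sub_rev]
    exact hk i j hij
  -- Now `c i` must be the difference `0 - (-c i)`, and `G i (x - t i)` must be centred at `-t i`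
  -- like `h (x + t i)`.
  choose G hG using fun i => exists_wavePacket h hcs 1 (-c i) ((-2 : ℝ) • t i)
  have hGm : ∀ i, fourierMass (G i) = fourierMass h ∧
      fourierMoment (G i) (-c i) = fourierMoment h 0 := fun i =>
    ⟨fourierMass_modulate_translate norm_one _ _ (hG i),
      fourierMoment_modulate_translate norm_one _ _ (hG i)⟩
  have happrox := norm_bilinearMultiplier_sum_sub_le H (lam k) hsmall (fun _ : Unit => h) G
    (fun _ j => j) (fun _ => 0) (fun j => -c j) (fun _ j => by simp) (fun _ => ⟨rfl, rfl⟩) hGm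
  simp only [Finset.univ_unique, Finset.sum_singleton, Fintype.card_fin, Fintype.card_unit,
    Nat.cast_one, one_mul] at happrox
  have herr : N * (4 / δ * (τ * δ / (4 * N))) = τ := by field_simp
  rw [herr] at happrox
  refine ⟨R, hR, ?_⟩
  have hlow := le_eLpNorm_of_le_on_balls (ι := Fin N) (c := 1 - τ) (s := fun i => -t i)
    (F := bilinearMultiplier (phaseSymbol (lam k) φ) h (∑ i, G i)) hR
    (fun i j hij => le_trans (by linarith) (hk' i j hij)) (by linarith) (fun i x hx => ?_) hr
  · rw [Fintype.card_fin] at hlow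
    refine hlow.trans ((hT k h (∑ i, G i)).trans ?_)
    gcongr
    · have := eLpNorm_sum_separated_le (ι := Unit) (f := h) (s := fun _ => 0) h1 hout
        (fun i j hij => absurd (Subsingleton.elim i j) hij) (fun _ _ => 1)
        (fun _ _ => norm_one) (fun x => by simp) p
      simpa using this
    · have := eLpNorm_sum_separated_le (f := ⇑(∑ i, G i)) (s := fun i => (-2 : ℝ) • t i) h1 hout
        (fun i j hij => ?_) (fun i x => 1 * expChar (inner ℝ (-c i) x))
        (fun i x => by rw [one_mul, norm_expChar]) (fun x => ?_) q
      · rwa [Fintype.card_fin] at this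
      · have h2 := hk i j hij
        rw [← smul_sub, norm_smul, Real.norm_eq_abs, abs_neg, abs_two]
        linarith [norm_nonneg (t i - t j)]
      · rw [sum_apply]
        exact Finset.sum_congr rfl fun i _ => hG i x
  · have hmain : ∑ j, expChar (lam k * β j / (2 * Real.pi)) * h (x + t j) * G j (x - t j) =
        expChar (lam k * β i / (2 * Real.pi)) * G i (x - t i) := by
      have := sum_separated_eq_single hout hk'
        (fun j => expChar (lam k * β j / (2 * Real.pi)) * G j (x - t j))
        (Metric.ball_subset_ball hRρ hx)
      rw [hin (x - -t i), mul_one] at this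
      · rw [← this]
        refine Finset.sum_congr rfl fun j _ => ?_
        rw [sub_neg_eq_add]
        ring
      · rwa [mem_ball_zero_iff, ← mem_ball_iff_norm]
    have hone : ‖expChar (lam k * β i / (2 * Real.pi)) * G i (x - t i)‖ = 1 := by
      rw [hG, show x - t i - (-2 : ℝ) • t i = x - -t i by rw [neg_smul, two_smul]; abel,
        hin (x - -t i)]
      · simp only [norm_mul, norm_expChar, norm_one, mul_one]
      · rwa [mem_ball_zero_iff, ← mem_ball_iff_norm]
    have := happrox x
    rw [hmain] at this
    have h3 := norm_sub_norm_le (expChar (lam k * β i / (2 * Real.pi)) * G i (x - t i))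
      (bilinearMultiplier (phaseSymbol (lam k) φ) h (∑ i, G i) x)
    rw [norm_sub_rev, hone] at h3
    linarith

/-- The diagonal products all sit on the ball about `0`, where their sum is a signed sum of
unimodular functions; `L²` is compared with `L^r` on that ball. -/
lemma UniformMultiplierBound.overlapping (H : IsPiecewiseAffine φ δ c α β)
    (hα : Function.Injective α) (hlam : ∀ C : ℝ, ∃ k, C < |lam k|) (hN : 0 < N) (hr : 2 ≤ r)
    (hT : UniformMultiplierBound φ lam p q r T) {ρ τ : ℝ} (hρ : 1 < ρ) (hτ : 0 < τ) :
    ∃ R : ℝ, 0 < R ∧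
      (N * volume (Metric.ball (0 : EuclideanSpace ℝ (Fin n)) R)) ^ (1 / 2 : ℝ) ≤
      T * (N * volume (Metric.ball (0 : EuclideanSpace ℝ (Fin n)) (ρ * R))) ^ (1 / p.toReal) *
        (N * volume (Metric.ball (0 : EuclideanSpace ℝ (Fin n)) (ρ * R))) ^ (1 / q.toReal) *
        volume (Metric.ball (0 : EuclideanSpace ℝ (Fin n)) R) ^ (1 / 2 - 1 / r.toReal) +
      ENNReal.ofReal τ * volume (Metric.ball (0 : EuclideanSpace ℝ (Fin n)) R) ^ (1 / 2 : ℝ) := by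
  have hδ := H.pos
  have hN' : (0 : ℝ) < N := by exact_mod_cast hN
  obtain ⟨R, hR, h, hcs, h1, hin, hout, hsmall⟩ :=
    -- All `N * N` pairs contribute to the error here.
    exists_concentrated_bump n hρ (κ := τ * δ / (4 * N * N)) (by positivity)
  have hRρ : R ≤ ρ * R := le_mul_of_one_le_left hR.le hρ.le
  obtain ⟨k, hk⟩ := exists_separated_dilate hα hlam (D := 2 * (ρ * R)) (by positivity)
  set t : Fin N → EuclideanSpace ℝ (Fin n) := fun i => (lam k / (2 * Real.pi)) • α i with ht
  have hk' : ∀ i j, i ≠ j → 2 * (ρ * R) ≤ ‖t i - t j‖ := hk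
  set B : Set (EuclideanSpace ℝ (Fin n)) := Metric.ball 0 R with hB
  set v : Fin N → EuclideanSpace ℝ (Fin n) → ℂ := fun i x =>
    expChar (lam k * β i / (2 * Real.pi)) * expChar (inner ℝ (c i) (x + t i)) with hv
  have hvc : ∀ i, Continuous (v i) := fun i => by
    have := continuous_expChar
    fun_prop
  have hv1 : ∀ i x, ‖v i x‖ₑ = 1 := fun i x => by
    rw [← ofReal_norm, hv]
    simp only [norm_mul, norm_expChar, mul_one, ENNReal.ofReal_one]
  -- The `v i` are the diagonal products on `B` without their signs; the signs are fixed first and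
  -- then built into the packets `F i`.
  obtain ⟨σ, hσ, hσle⟩ := exists_signs_lintegral_le (volume.restrict B) v
    (fun i => (hvc i).measurable) Finset.univ
  choose F hF using fun i => exists_wavePacket h hcs (σ i) (c i) (t i)
  choose G hG using fun i => exists_wavePacket h hcs 1 0 (-t i)
  have hFm : ∀ i, fourierMass (F i) = fourierMass h ∧
      fourierMoment (F i) (c i) = fourierMoment h 0 := fun i =>
    ⟨fourierMass_modulate_translate (hσ i) _ _ (hF i),
      fourierMoment_modulate_translate (hσ i) _ _ (hF i)⟩
  have hGm : ∀ i, fourierMass (G i) = fourierMass h ∧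
      fourierMoment (G i) 0 = fourierMoment h 0 := fun i =>
    ⟨fourierMass_modulate_translate norm_one _ _ (hG i),
      fourierMoment_modulate_translate norm_one _ _ (hG i)⟩
  have happrox := norm_bilinearMultiplier_sum_sub_le H (lam k) hsmall F G
    (fun i _ => i) c (fun _ => 0) (fun i _ => sub_zero _) hFm hGm
  simp only [Fintype.card_fin] at happrox
  have herr : (N : ℝ) * (N * (4 / δ * (τ * δ / (4 * N * N)))) = τ := by field_simp
  rw [herr] at happrox
  set M := bilinearMultiplier (phaseSymbol (lam k) φ) (∑ i, F i) (∑ i, G i) with hM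
  have hMm : AEStronglyMeasurable M (volume.restrict B) :=
    (stronglyMeasurable_bilinearMultiplier
      (measurable_phaseSymbol _ H.measurable) _ _).aestronglyMeasurable
  set S : EuclideanSpace ℝ (Fin n) → ℂ := fun x => ∑ i, σ i * v i x with hS
  have hSc : Continuous S := by fun_prop
  have hMS : ∀ x ∈ B, ‖S x - M x‖ ≤ τ := by
    intro x hx
    have hSx : S x = ∑ i, ∑ j, expChar (lam k * β i / (2 * Real.pi)) * F i (x + t i) *
        G j (x - t i) := by
      refine Finset.sum_congr rfl fun i _ => ?_
      -- For `x` in `B` the bump `G j (x - t i)` vanishes unless `j = i`, since `t i` and `t j` are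
      -- at least `2ρR` apart and `‖x‖ < R`.
      rw [Finset.sum_eq_single i]
      · rw [hF, hG, add_sub_cancel_right, sub_neg_eq_add, sub_add_cancel, hin x hx,
          inner_zero_left, expChar_zero, hv]
        ring
      · intro j _ hji
        rw [hG, hout, mul_zero, mul_zero]
        rw [mem_ball_zero_iff, not_lt]
        have h4 := hk' i j hji.symm
        have h5 : ‖t i - t j‖ ≤ ‖x‖ + ‖x - t i - -t j‖ := by
          rw [show t i - t j = x - (x - t i - -t j) by abel]
          exact norm_sub_le _ _
        have h6 := mem_ball_zero_iff.1 hx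
        linarith
      · exact fun hi => absurd (Finset.mem_univ i) hi
    rw [hSx, norm_sub_rev]
    exact happrox x
  refine ⟨R, hR, ?_⟩
  have hlow : (N * volume B) ^ (1 / 2 : ℝ) ≤ eLpNorm S 2 (volume.restrict B) := by
    rw [eLpNorm_eq_lintegral_rpow_enorm_toReal two_ne_zero ENNReal.ofNat_ne_top]
    simp only [ENNReal.toReal_ofNat, ENNReal.rpow_two]
    gcongr
    refine le_trans (le_of_eq ?_) hσle
    simp only [hv1, one_pow, lintegral_one, Measure.restrict_apply_univ, Finset.sum_const,
      Finset.card_univ, Fintype.card_fin, nsmul_eq_mul]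
  have htri : eLpNorm S 2 (volume.restrict B) ≤ eLpNorm M 2 (volume.restrict B) +
      eLpNorm (S - M) 2 (volume.restrict B) := by
    have := eLpNorm_add_le (p := 2) hMm (hSc.aestronglyMeasurable.sub hMm) (by norm_num)
    rwa [add_sub_cancel] at this
  have herr2 : eLpNorm (S - M) 2 (volume.restrict B) ≤
      ENNReal.ofReal τ * volume B ^ (1 / 2 : ℝ) := by
    have := eLpNorm_le_of_ae_bound (p := 2) (f := S - M) (C := τ) (μ := volume.restrict B)
      ((ae_restrict_iff' measurableSet_ball).2 (Filter.Eventually.of_forall hMS))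
    rw [Measure.restrict_apply_univ] at this
    rw [mul_comm]
    simpa using this
  have hM2 : eLpNorm M 2 (volume.restrict B) ≤
      eLpNorm M r volume * volume B ^ (1 / 2 - 1 / r.toReal) := by
    have := eLpNorm_le_eLpNorm_mul_rpow_measure_univ hr hMm
    rw [Measure.restrict_apply_univ, ENNReal.toReal_ofNat] at this
    refine this.trans ?_
    gcongr
    exact Measure.restrict_le_self
  refine hlow.trans (htri.trans (add_le_add (hM2.trans ?_) herr2))
  gcongr
  refine (hT k (∑ i, F i) (∑ i, G i)).trans ?_
  gcongr
  · have := eLpNorm_sum_separated_le (f := ⇑(∑ i, F i)) (s := t) h1 hout hk'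
      (fun i x => σ i * expChar (inner ℝ (c i) x))
      (fun i x => by rw [norm_mul, norm_expChar, hσ, one_mul]) (fun x => ?_) p
    · rwa [Fintype.card_fin] at this
    · rw [sum_apply]
      exact Finset.sum_congr rfl fun i _ => hF i x
  · have := eLpNorm_sum_separated_le (f := ⇑(∑ i, G i)) (s := fun i => -t i) h1 hout
      (fun i j hij => ?_) (fun i x => 1 * expChar (inner ℝ 0 x))
      (fun i x => by rw [norm_mul, norm_expChar, norm_one, one_mul]) (fun x => ?_) q
    · rwa [Fintype.card_fin] at this
    · rw [neg_sub_neg, norm_sub_rev]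
      exact hk' i j hij
    · rw [sum_apply]
      exact Finset.sum_congr rfl fun i _ => hG i x

end

/-! ### Removing the volumes and letting `τ → 0`. -/

lemma le_of_forall_le_of_continuousAt_zero {f g : ℝ → ℝ} (hf : ContinuousAt f 0)
    (hg : ContinuousAt g 0) (h : ∀ τ, 0 < τ → τ ≤ 1 → f τ ≤ g τ) : f 0 ≤ g 0 := by
  refine le_of_tendsto_of_tendsto (hf.tendsto.mono_left nhdsWithin_le_nhds)
    (hg.tendsto.mono_left (nhdsWithin_le_nhds (s := Set.Ioi 0))) ?_
  filter_upwards [Ioc_mem_nhdsGT (zero_lt_one' ℝ)] with τ hτ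
  exact h τ hτ.1 hτ.2

lemma volume_ball_mul (n : ℕ) {ρ : ℝ} (hρ : 0 < ρ) (R : ℝ) :
    volume (Metric.ball (0 : EuclideanSpace ℝ (Fin n)) (ρ * R)) =
      ENNReal.ofReal (ρ ^ n) * volume (Metric.ball (0 : EuclideanSpace ℝ (Fin n)) R) := by
  rw [Measure.addHaar_ball_mul_of_pos volume 0 hρ R, finrank_euclideanSpace, Fintype.card_fin]

/-- Here `V` is the volume of the ball of radius `R`, `A = ρ^n`, `a = 1/p` and `b = 1/q`. As `1/r =
a + b`, the factor `N^a V^(a+b)` cancels, so the unknown `R` disappears. -/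
lemma rpow_mul_le_of_separated {N : ℕ} (hN : 0 < N) {T V : ℝ≥0∞} (hT : T ≠ ∞) (hV : V ≠ ∞)
    (hV0 : V ≠ 0) {a b A s : ℝ} (ha : 0 ≤ a) (hb : 0 ≤ b) (hA : 0 < A) (hs : 0 ≤ s)
    (h : ENNReal.ofReal s * (N * V) ^ (a + b) ≤
      T * (N * (ENNReal.ofReal A * V)) ^ a * (ENNReal.ofReal A * V) ^ b) :
    (N : ℝ) ^ b * s ≤ T.toReal * A ^ (a + b) := by
  have hN' : (0 : ℝ) < N := by exact_mod_cast hN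
  have hAV : ENNReal.ofReal A * V ≠ ∞ := ENNReal.mul_ne_top ENNReal.ofReal_ne_top hV
  have hNAV : N * (ENNReal.ofReal A * V) ≠ ∞ := ENNReal.mul_ne_top (ENNReal.natCast_ne_top N) hAV
  have h2 := ENNReal.toReal_mono (ENNReal.mul_ne_top (ENNReal.mul_ne_top hT
    (ENNReal.rpow_ne_top_of_nonneg ha hNAV)) (ENNReal.rpow_ne_top_of_nonneg hb hAV)) h
  have hv : 0 < V.toReal := ENNReal.toReal_pos hV0 hV
  simp only [ENNReal.toReal_mul, ← ENNReal.toReal_rpow, ENNReal.toReal_ofReal hs,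
    ENNReal.toReal_ofReal hA.le, ENNReal.toReal_natCast] at h2
  rw [Real.mul_rpow hN'.le hv.le, Real.mul_rpow hN'.le (by positivity), Real.mul_rpow hA.le hv.le,
    Real.mul_rpow hA.le hv.le, Real.rpow_add hN', Real.rpow_add hv] at h2
  rw [Real.rpow_add hA]
  have hpos : 0 < (N : ℝ) ^ a * (V.toReal ^ a * V.toReal ^ b) := by positivity
  refine le_of_mul_le_mul_right ?_ hpos
  calc _ = _ := by ring
    _ ≤ _ := h2
    _ = _ := by ring

lemma rpow_half_le_of_overlapping {N : ℕ} (hN : 0 < N) {T V : ℝ≥0∞} (hT : T ≠ ∞) (hV : V ≠ ∞)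
    (hV0 : V ≠ 0) {a b A τ : ℝ} (ha : 0 ≤ a) (hb : 0 ≤ b) (hA : 0 < A) (hτ : 0 ≤ τ)
    (h : (N * V) ^ (1 / 2 : ℝ) ≤
      T * (N * (ENNReal.ofReal A * V)) ^ a * (N * (ENNReal.ofReal A * V)) ^ b *
        V ^ (1 / 2 - (a + b)) + ENNReal.ofReal τ * V ^ (1 / 2 : ℝ)) :
    (N : ℝ) ^ (1 / 2 : ℝ) ≤ T.toReal * (N : ℝ) ^ (a + b) * A ^ (a + b) + τ := by
  have hN' : (0 : ℝ) < N := by exact_mod_cast hN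
  have hAV : ENNReal.ofReal A * V ≠ ∞ := ENNReal.mul_ne_top ENNReal.ofReal_ne_top hV
  have hNAV : N * (ENNReal.ofReal A * V) ≠ ∞ := ENNReal.mul_ne_top (ENNReal.natCast_ne_top N) hAV
  have ht1 : T * (N * (ENNReal.ofReal A * V)) ^ a * (N * (ENNReal.ofReal A * V)) ^ b *
        V ^ (1 / 2 - (a + b)) ≠ ∞ :=
    ENNReal.mul_ne_top (ENNReal.mul_ne_top (ENNReal.mul_ne_top hT
      (ENNReal.rpow_ne_top_of_nonneg ha hNAV)) (ENNReal.rpow_ne_top_of_nonneg hb hNAV))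
      (ENNReal.rpow_ne_top_of_ne_zero hV0 hV)
  have ht2 : ENNReal.ofReal τ * V ^ (1 / 2 : ℝ) ≠ ∞ :=
    ENNReal.mul_ne_top ENNReal.ofReal_ne_top (ENNReal.rpow_ne_top_of_ne_zero hV0 hV)
  have h2 := ENNReal.toReal_mono (ENNReal.add_ne_top.2 ⟨ht1, ht2⟩) h
  rw [ENNReal.toReal_add ht1 ht2] at h2
  have hv : 0 < V.toReal := ENNReal.toReal_pos hV0 hV
  simp only [ENNReal.toReal_mul, ← ENNReal.toReal_rpow, ENNReal.toReal_ofReal hτ,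
    ENNReal.toReal_ofReal hA.le, ENNReal.toReal_natCast] at h2
  rw [Real.mul_rpow hN'.le hv.le, Real.mul_rpow hN'.le (by positivity),
    Real.mul_rpow hN'.le (by positivity), Real.mul_rpow hA.le hv.le,
    Real.mul_rpow hA.le hv.le, Real.rpow_sub hv, Real.rpow_add hv] at h2
  rw [Real.rpow_add hA, Real.rpow_add hN']
  have hpos : 0 < V.toReal ^ (1 / 2 : ℝ) := by positivity
  refine le_of_mul_le_mul_right (h2.trans (le_of_eq ?_)) hpos
  have := (Real.rpow_pos_of_pos hv a).ne'
  have := (Real.rpow_pos_of_pos hv b).ne'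
  field_simp

lemma one_div_toReal_add {p q r : ℝ≥0∞} (hp : 0 < p) (hq : 0 < q) (hpqr : p⁻¹ + q⁻¹ = r⁻¹) :
    1 / r.toReal = 1 / p.toReal + 1 / q.toReal := by
  simp only [one_div, ← ENNReal.toReal_inv]
  rw [← hpqr, ENNReal.toReal_add (ENNReal.inv_ne_top.2 hp.ne') (ENNReal.inv_ne_top.2 hq.ne')]

lemma norm_sub_le_imp_mem_cube {n : ℕ} {c t : EuclideanSpace ℝ (Fin n)} {δ l : ℝ} (hδ : δ ≤ l / 2)
    (ht : ‖t - c‖ < δ) : t ∈ cube c l := fun i => by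
  have := PiLp.norm_apply_le (t - c) i
  rw [PiLp.sub_apply, Real.norm_eq_abs] at this
  linarith

lemma exists_isPiecewiseAffine {n N : ℕ} {φ : EuclideanSpace ℝ (Fin n) → ℝ} (hφ : Measurable φ)
    {Q : Fin N → Set (EuclideanSpace ℝ (Fin n))} (hQ : ∀ k, IsCube (Q k))
    {α : Fin N → EuclideanSpace ℝ (Fin n)} {β : Fin N → ℝ}
    (haff : ∀ k, ∀ᵐ t ∂(volume.restrict (Q k)), φ t = inner ℝ (α k) t + β k) :
    ∃ δ c, IsPiecewiseAffine φ δ c α β := by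
  choose c l hl hQc using hQ
  obtain ⟨δ, hδ, hδl⟩ : ∃ δ : ℝ, 0 < δ ∧ ∀ k, δ ≤ l k / 2 := by
    have h1 : ∀ᶠ δ in nhdsWithin (0 : ℝ) (Set.Ioi 0), ∀ k, δ ≤ l k / 2 := by
      rw [Filter.eventually_all]
      intro k
      filter_upwards [Ioc_mem_nhdsGT (half_pos (hl k))] with δ hδ
      exact hδ.2
    obtain ⟨δ, h2, h3⟩ := (h1.and self_mem_nhdsWithin).exists
    exact ⟨δ, h3, h2⟩
  refine ⟨δ, c, hφ, hδ, fun k => ?_⟩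
  have hball : ∀ᵐ t ∂(volume.restrict (Metric.ball (c k) δ)), φ t = inner ℝ (α k) t + β k := by
    refine ae_restrict_of_ae_restrict_of_subset (fun t ht => ?_) (haff k)
    rw [hQc]
    exact norm_sub_le_imp_mem_cube (hδl k) (mem_ball_iff_norm.1 ht)
  filter_upwards [(ae_restrict_iff' measurableSet_ball).1 hball] with t ht hlt
  exact ht (mem_ball_iff_norm.2 hlt)

/-! ### The three lower bounds for `T`. -/

section
variable {n N : ℕ} {φ : EuclideanSpace ℝ (Fin n) → ℝ} {δ : ℝ}
  {c α : Fin N → EuclideanSpace ℝ (Fin n)} {β : Fin N → ℝ} {lam : ℕ → ℝ} {p q r T : ℝ≥0∞}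

lemma UniformMultiplierBound.rpow_inv_right_le (H : IsPiecewiseAffine φ δ c α β)
    (hα : Function.Injective α) (hlam : ∀ C : ℝ, ∃ k, C < |lam k|) (hN : 0 < N) (hr : r ≠ 0)
    (hpqr : 1 / r.toReal = 1 / p.toReal + 1 / q.toReal) (hTtop : T ≠ ∞)
    (hT : UniformMultiplierBound φ lam p q r T) :
    (N : ℝ) ^ (1 / q.toReal) ≤ T.toReal := by
  have key : ∀ τ : ℝ, 0 < τ → τ ≤ 1 → (N : ℝ) ^ (1 / q.toReal) * (1 - τ) ≤
      T.toReal * ((1 + τ) ^ n) ^ (1 / r.toReal) := by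
    intro τ hτ hτ1
    obtain ⟨R, hR, h⟩ := hT.separated_left H hα hlam hN hr (ρ := 1 + τ) (by linarith) hτ hτ1
    rw [volume_ball_mul n (by linarith), hpqr] at h
    rw [hpqr]
    exact rpow_mul_le_of_separated hN hTtop measure_ball_lt_top.ne
      (Metric.measure_ball_pos volume _ hR).ne' (by positivity) (by positivity) (by positivity)
      (by linarith) h
  simpa using le_of_forall_le_of_continuousAt_zero
    (f := fun τ => (N : ℝ) ^ (1 / q.toReal) * (1 - τ))
    (g := fun τ => T.toReal * ((1 + τ) ^ n) ^ (1 / r.toReal)) (by fun_prop)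
    (continuousAt_const.mul
      (ContinuousAt.rpow_const (by fun_prop) (Or.inl (by simp)))) key

lemma UniformMultiplierBound.rpow_inv_left_le (H : IsPiecewiseAffine φ δ c α β)
    (hα : Function.Injective α) (hlam : ∀ C : ℝ, ∃ k, C < |lam k|) (hN : 0 < N) (hr : r ≠ 0)
    (hpqr : 1 / r.toReal = 1 / p.toReal + 1 / q.toReal) (hTtop : T ≠ ∞)
    (hT : UniformMultiplierBound φ lam p q r T) :
    (N : ℝ) ^ (1 / p.toReal) ≤ T.toReal := by
  have key : ∀ τ : ℝ, 0 < τ → τ ≤ 1 → (N : ℝ) ^ (1 / p.toReal) * (1 - τ) ≤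
      T.toReal * ((1 + τ) ^ n) ^ (1 / r.toReal) := by
    intro τ hτ hτ1
    obtain ⟨R, hR, h⟩ := hT.separated_right H hα hlam hN hr (ρ := 1 + τ) (by linarith) hτ hτ1
    -- The two factors are swapped so that the one carrying `N` comes first; `1/p` and `1/q`
    -- exchange roles.
    rw [volume_ball_mul n (by linarith), hpqr, add_comm, mul_right_comm] at h
    rw [hpqr, add_comm (1 / p.toReal)]
    exact rpow_mul_le_of_separated hN hTtop measure_ball_lt_top.ne
      (Metric.measure_ball_pos volume _ hR).ne' (by positivity) (by positivity) (by positivity)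
      (by linarith) h
  simpa using le_of_forall_le_of_continuousAt_zero
    (f := fun τ => (N : ℝ) ^ (1 / p.toReal) * (1 - τ))
    (g := fun τ => T.toReal * ((1 + τ) ^ n) ^ (1 / r.toReal)) (by fun_prop)
    (continuousAt_const.mul
      (ContinuousAt.rpow_const (by fun_prop) (Or.inl (by simp)))) key

lemma UniformMultiplierBound.rpow_half_sub_le (H : IsPiecewiseAffine φ δ c α β)
    (hα : Function.Injective α) (hlam : ∀ C : ℝ, ∃ k, C < |lam k|) (hN : 0 < N) (hr : 2 ≤ r)
    (hpqr : 1 / r.toReal = 1 / p.toReal + 1 / q.toReal) (hTtop : T ≠ ∞)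
    (hT : UniformMultiplierBound φ lam p q r T) :
    (N : ℝ) ^ (1 / 2 - 1 / r.toReal) ≤ T.toReal := by
  have hN' : (0 : ℝ) < N := by exact_mod_cast hN
  have key : ∀ τ : ℝ, 0 < τ → τ ≤ 1 → (N : ℝ) ^ (1 / 2 : ℝ) ≤
      T.toReal * (N : ℝ) ^ (1 / r.toReal) * ((1 + τ) ^ n) ^ (1 / r.toReal) + τ := by
    intro τ hτ _
    obtain ⟨R, hR, h⟩ := hT.overlapping H hα hlam hN hr (ρ := 1 + τ) (by linarith) hτ
    rw [volume_ball_mul n (by linarith), hpqr] at h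
    rw [hpqr]
    exact rpow_half_le_of_overlapping hN hTtop measure_ball_lt_top.ne
      (Metric.measure_ball_pos volume _ hR).ne' (by positivity) (by positivity) (by positivity)
      hτ.le h
  have h0 := le_of_forall_le_of_continuousAt_zero
    (f := fun _ => (N : ℝ) ^ (1 / 2 : ℝ))
    (g := fun τ => T.toReal * (N : ℝ) ^ (1 / r.toReal) * ((1 + τ) ^ n) ^ (1 / r.toReal) + τ)
    (by fun_prop) ((continuousAt_const.mul
      (ContinuousAt.rpow_const (by fun_prop) (Or.inl (by simp)))).add continuousAt_id) key
  simp only [add_zero, one_pow, Real.one_rpow, mul_one] at h0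
  rwa [Real.rpow_sub hN', div_le_iff₀ (by positivity)]

end

theorem lemma2p2 {n : ℕ} (p q r : ℝ≥0∞) (hp : 0 < p) (hq : 0 < q) (hr : 0 < r)
    (hpqr : p⁻¹ + q⁻¹ = r⁻¹)
    (φ : EuclideanSpace ℝ (Fin n) → ℝ) (hφ : Measurable φ)
    (N : ℕ) (hN : 0 < N)
    (Q : Fin N → Set (EuclideanSpace ℝ (Fin n))) (hQ : ∀ k, IsCube (Q k))
    (α : Fin N → EuclideanSpace ℝ (Fin n)) (hα : Function.Injective α) (β : Fin N → ℝ)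
    (haff : ∀ k, ∀ᵐ t ∂(volume.restrict (Q k)), φ t = inner ℝ (α k) t + β k)
    (lam : ℕ → ℝ) (hlam : ∀ C : ℝ, ∃ k, C < |lam k|) :
    ENNReal.ofReal
        ((N : ℝ) ^ (max (max (p⁻¹).toReal (q⁻¹).toReal) (1 - (r⁻¹).toReal) - 1 / 2 : ℝ)) ≤
      ⨆ k : ℕ, bilinearMultiplierNorm p q r
        (fun ξ η => Complex.exp (Complex.I * ((lam k * φ (ξ - η) : ℝ) : ℂ))) := by
  obtain ⟨δ, c, H⟩ := exists_isPiecewiseAffine hφ hQ haff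
  have hexp := one_div_toReal_add hp hq hpqr
  have hN1 : (1 : ℝ) ≤ N := by exact_mod_cast hN
  by_contra! hlt
  -- A value strictly above the supremum is finite and exceeds an admissible constant for every `k`,
  -- so no infimum has to be attained.
  obtain ⟨T, hT1, hT2⟩ := exists_between hlt
  have hTtop : T ≠ ∞ := hT2.ne_top
  have hT : UniformMultiplierBound φ lam p q r T := by
    intro k f g
    have hk : bilinearMultiplierNorm p q r (phaseSymbol (lam k) φ) < T :=
      (le_iSup (fun k => bilinearMultiplierNorm p q r (phaseSymbol (lam k) φ)) k).trans_lt hT1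
    obtain ⟨C, hC, hCT⟩ := sInf_lt_iff.1 hk
    refine (hC f g).trans ?_
    gcongr
  have hle1 := hT.rpow_inv_left_le H hα hlam hN hr.ne' hexp hTtop
  have hle2 := hT.rpow_inv_right_le H hα hlam hN hr.ne' hexp hTtop
  have hle3 : (N : ℝ) ^ (1 / 2 - 1 / r.toReal) ≤ T.toReal := by
    rcases le_or_gt 2 r with h2 | h2
    · exact hT.rpow_half_sub_le H hα hlam hN h2 hexp hTtop
    -- For `r < 2` the exponent `1/2 - 1/r` is negative, so the bound follows from the one with
    -- exponent `1/p ≥ 0`.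
    · refine le_trans (Real.rpow_le_rpow_of_exponent_le hN1 ?_) hle1
      have hr0 : 0 < r.toReal := ENNReal.toReal_pos hr.ne' h2.ne_top
      have hr2 : r.toReal ≤ 2 := by
        simpa using ENNReal.toReal_mono ENNReal.ofNat_ne_top h2.le
      have : 1 / 2 ≤ 1 / r.toReal := one_div_le_one_div_of_le hr0 hr2
      have : 0 ≤ 1 / p.toReal := by positivity
      linarith
  refine absurd hT2 (not_lt.2 ?_)
  rw [← ENNReal.ofReal_toReal hTtop]
  refine ENNReal.ofReal_le_ofReal ?_
  rw [ENNReal.toReal_inv, ENNReal.toReal_inv, ENNReal.toReal_inv, ← one_div, ← one_div, ← one_div]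
  rcases max_cases (max (1 / p.toReal) (1 / q.toReal)) (1 - 1 / r.toReal) with ⟨h, -⟩ | ⟨h, -⟩
  · rw [h]
    rcases max_cases (1 / p.toReal) (1 / q.toReal) with ⟨h, -⟩ | ⟨h, -⟩
    · rw [h]
      exact (Real.rpow_le_rpow_of_exponent_le hN1 (by linarith)).trans hle1
    · rw [h]
      exact (Real.rpow_le_rpow_of_exponent_le hN1 (by linarith)).trans hle2
  · rw [h, show 1 - 1 / r.toReal - 1 / 2 = 1 / 2 - 1 / r.toReal by ring]
    exact hle3
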